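/- Consider a Mach–Zehnder interferometer with path qubit $Q$ (basis $|0\rangle,|1\rangle$), polarisation qubit $P$ (basis $|H\rangle,|V\rangle$) and an environment $F$ described by a finite-dimensional Hilbert space. Let $\mathcal{E}$ be a completely positive trace-preserving map from operators on $Q$ to operators on $Q\otimes F$ (the interaction inside the interferometer) that is path-preserving: $\mathrm{Tr}_F\,\mathcal{E}(|j\rangle\langle j|)=|j\rangle\langle j|$ for $j=0,1$. Let $\rho_P$ be any density operator on $P$, let $0\le R\le 1$, and let the second beam splitter be the controlled unitary $$U_{PQ}=|H\rangle\langle H|\otimes \mathbb{1}+|V\rangle\langle V|\otimes U(R),\qquad U(R)=\begin{pmatrix}\sqrt{R}&\sqrt{1-R}\\ \sqrt{1-R}&-\sqrt{R}\end{pmatrix}.$$ For an operator $X$ on $Q\otimes F$ let $$\mathcal{B}(X)=\mathrm{Tr}_Q\big[\,|0\rangle\langle 0|_Q\;(U_{PQ}\otimes\mathbb{1}_F)(\rho_P\otimes X)(U_{PQ}\otimes\mathbb{1}_F)^\dagger\,\big],$$ the unnormalised state of $P\otimes F$ after the beam splitter when detector $D_0$ clicks. Input distinguishability: $j\in\{0,1\}$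 is chosen uniformly at random and $|j\rangle$ is sent into the interferometer. Given that $D_0$ clicks, the subnormalised states of the output polarisation and the environment are $\sigma_j=\tfrac12\mathcal{B}(\mathcal{E}(|j\rangle\langle j|))\big/\sum_k \tfrac12\mathrm{Tr}\,\mathcal{B}(\mathcal{E}(|k\rangle\langle k|))$. Put $$p_{\mathrm{guess}}(Z_i|FP)_{D_0}=\max_{M_0,M_1\ge0,\;M_0+M_1=\mathbb{1}}\big[\mathrm{Tr}(M_0\sigma_0)+\mathrm{Tr}(M_1\sigma_1)\big],\qquad \mathcal{D}_i^P=2\,p_{\mathrm{guess}}(Z_i|FP)_{D_0}-1 .$$ Fringe visibility: for the input $|\psi\rangle=(|0\rangle+e^{i\theta}|1\rangle)/\sqrt2$ with any real $\theta$, and the phase shift $U_\phi=|0\rangle\langle0|+e^{i\phi}|1\rangle\langle1|$ applied to $Q$ before the second beam splitter, let $p^{D_0}(\phi)=\mathrm{Tr}\,\mathcal{B}\big((U_\phi\otimes\mathbb{1}_F)\,\mathcal{E}(|\psi\rangle\langle\psi|)\,(U_\phi\otimes\mathbb{1}_F)^\dagger\big)$ and $$\mathcal{V}=\frac{\max_\phi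 p^{D_0}(\phi)-\min_\phi p^{D_0}(\phi)}{\max_\phi p^{D_0}(\phi)+\min_\phi p^{D_0}(\phi)} .$$ Then $$(\mathcal{D}_i^P)^2+\mathcal{V}^2\le 1 .$$ -/

import Mathlib

open Matrix
open scoped Kronecker ComplexOrder

noncomputable section

namespace QBS

/-- The which-path qubit `Q`; `0` and `1` are the two arms of the interferometer
(and, after the second beam splitter, the modes leading to the detectors `D₀` and `D₁`). -/
abbrev Path := Fin 2

/-- The polarisation qubit `P`; `0` is horizontal (`H`) and `1` is vertical (`V`). -/
abbrev Pol := Fin 2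

/-- The rank-one projector `|j⟩⟨j|` onto a standard basis vector. -/
def proj {n : Type*} [DecidableEq n] (j : n) : Matrix n n ℂ := Matrix.single j j 1

/-- Density matrices: positive semidefinite of unit trace. -/
def IsState {n : Type*} [Fintype n] (ρ : Matrix n n ℂ) : Prop :=
  ρ.PosSemidef ∧ ρ.trace = 1

/-- The ampliation `id_k ⊗ Φ`, acting block by block. -/
def ampliation {m n : Type*} (k : ℕ) (Φ : Matrix m m ℂ →ₗ[ℂ] Matrix n n ℂ)
    (X : Matrix (Fin k × m) (Fin k × m) ℂ) : Matrix (Fin k × n) (Fin k × n) ℂ :=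
  Matrix.of fun x y => Φ (Matrix.of fun i j => X (x.1, i) (y.1, j)) x.2 y.2

/-- Quantum channels: completely positive trace-preserving linear maps. -/
structure IsChannel {m n : Type*} [Fintype m] [Fintype n]
    (Φ : Matrix m m ℂ →ₗ[ℂ] Matrix n n ℂ) : Prop where
  completelyPositive : ∀ (k : ℕ) (X : Matrix (Fin k × m) (Fin k × m) ℂ),
    X.PosSemidef → (ampliation k Φ X).PosSemidef
  tracePreserving : ∀ X : Matrix m m ℂ, (Φ X).trace = X.trace

/-- The partial trace `Tr_F` from `Q F` to `Q`. -/
def traceEnv {F : Type*} [Fintype F] (X : Matrix (Path × F) (Path × F) ℂ) :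
    Matrix Path Path ℂ :=
  Matrix.of fun i j => ∑ f, X (i, f) (j, f)

/-- The interaction `ℰ : Q → Q F` is path preserving if its reduced channel `Tr_F ∘ ℰ` fixes
`|0⟩⟨0|` and `|1⟩⟨1|`. -/
def IsPathPreserving {F : Type*} [Fintype F]
    (E : Matrix Path Path ℂ →ₗ[ℂ] Matrix (Path × F) (Path × F) ℂ) : Prop :=
  ∀ j : Path, traceEnv (E (proj j)) = proj j

/-- The unitary `U_φ = |0⟩⟨0| + e^{iφ} |1⟩⟨1|` of the phase shifter in the lower arm. -/
def phaseUnitary (φ : ℝ) : Matrix Path Path ℂ :=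
  proj 0 + Complex.exp (φ * Complex.I) • proj 1

/-- The phase shift `X ↦ (U_φ ⊗ 1) X (U_φ ⊗ 1)†` on `Q F`. -/
def phaseShift {F : Type*} [Fintype F] [DecidableEq F] (φ : ℝ)
    (X : Matrix (Path × F) (Path × F) ℂ) : Matrix (Path × F) (Path × F) ℂ :=
  (phaseUnitary φ ⊗ₖ (1 : Matrix F F ℂ)) * X * (phaseUnitary φ ⊗ₖ (1 : Matrix F F ℂ))ᴴ

/-- The beam-splitter unitary `U(R)` with reflection probability `R`. -/
def beamSplitter (R : ℝ) : Matrix Path Path ℂ :=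
  !![((√R : ℝ) : ℂ), ((√(1 - R) : ℝ) : ℂ); ((√(1 - R) : ℝ) : ℂ), -((√R : ℝ) : ℂ)]

/-- The quantum beam splitter `U_{PQ} = |H⟩⟨H| ⊗ 1 + |V⟩⟨V| ⊗ U(R)`. -/
def controlledBeamSplitter (R : ℝ) : Matrix (Pol × Path) (Pol × Path) ℂ :=
  proj (0 : Pol) ⊗ₖ (1 : Matrix Path Path ℂ) + proj (1 : Pol) ⊗ₖ beamSplitter R

/-- The unitary `U_{PQ} ⊗ 1_F` on `P Q F`. -/
def controlledBeamSplitterEnv (F : Type*) [DecidableEq F] (R : ℝ) :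
    Matrix (Pol × Path × F) (Pol × Path × F) ℂ :=
  Matrix.reindex (Equiv.prodAssoc Pol Path F) (Equiv.prodAssoc Pol Path F)
    (controlledBeamSplitter R ⊗ₖ (1 : Matrix F F ℂ))

/-- The (unnormalised) state of `P F` after a click of detector `D₀`, namely
`Tr_Q [(1_P ⊗ |0⟩⟨0|_Q ⊗ 1_F) X]`. -/
def detectD0 {F : Type*} [Fintype F] [DecidableEq F]
    (X : Matrix (Pol × Path × F) (Pol × Path × F) ℂ) : Matrix (Pol × F) (Pol × F) ℂ :=
  Matrix.of fun x y => ∑ q : Path,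
    (((1 : Matrix Pol Pol ℂ) ⊗ₖ (proj (0 : Path) ⊗ₖ (1 : Matrix F F ℂ))) * X)
      (x.1, q, x.2) (y.1, q, y.2)

/-- The final stage of the interferometer. The quanton and the environment arrive in `X`, the
polarisation in `ρP`; the quantum beam splitter acts and `D₀` clicks. The result is the
unnormalised state of `P F`, whose trace is the probability of the click if `X` is a state. -/
def qbsOutput {F : Type*} [Fintype F] [DecidableEq F] (ρP : Matrix Pol Pol ℂ) (R : ℝ)
    (X : Matrix (Path × F) (Path × F) ℂ) : Matrix (Pol × F) (Pol × F) ℂ :=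
  detectD0 (controlledBeamSplitterEnv F R * (ρP ⊗ₖ X) * (controlledBeamSplitterEnv F R)ᴴ)

/-- The optimal probability to guess the bit `j` from a system `B`, where `σ j` is the
subnormalised state of `B` that goes with the value `j`: the supremum over two-outcome POVMs
`{M 0, M 1}` on `B` of `Tr (M 0 σ 0) + Tr (M 1 σ 1)`. -/
def guessProb {B : Type*} [Fintype B] [DecidableEq B] (σ : Fin 2 → Matrix B B ℂ) : ℝ :=
  sSup {p : ℝ | ∃ M : Fin 2 → Matrix B B ℂ, (∀ j, (M j).PosSemidef) ∧ ∑ j, M j = 1 ∧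
    p = (∑ j, (M j * σ j).trace).re}

/-- The joint weight of "Bob's fair coin shows `j`, he sends `|j⟩`, and `D₀` clicks", as an
unnormalised state of `P F`. -/
def jointOutput {F : Type*} [Fintype F] [DecidableEq F]
    (E : Matrix Path Path ℂ →ₗ[ℂ] Matrix (Path × F) (Path × F) ℂ)
    (ρP : Matrix Pol Pol ℂ) (R : ℝ) (j : Fin 2) : Matrix (Pol × F) (Pol × F) ℂ :=
  (1 / 2 : ℂ) • qbsOutput ρP R (E (proj j))

/-- The conditional ensemble of `j` and `P F` given the click of `D₀`. -/
def conditionalOutput {F : Type*} [Fintype F] [DecidableEq F]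
    (E : Matrix Path Path ℂ →ₗ[ℂ] Matrix (Path × F) (Path × F) ℂ)
    (ρP : Matrix Pol Pol ℂ) (R : ℝ) (j : Fin 2) : Matrix (Pol × F) (Pol × F) ℂ :=
  (∑ k, (jointOutput E ρP R k).trace)⁻¹ • jointOutput E ρP R j

/-- The polarisation-enhanced input distinguishability
`𝒟ᵢᴾ = 2 p_guess(Zᵢ | F P)_{D₀} - 1`. -/
def inputDistinguishability {F : Type*} [Fintype F] [DecidableEq F]
    (E : Matrix Path Path ℂ →ₗ[ℂ] Matrix (Path × F) (Path × F) ℂ)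
    (ρP : Matrix Pol Pol ℂ) (R : ℝ) : ℝ :=
  2 * guessProb (conditionalOutput E ρP R) - 1

/-- The unbiased input vector `(|0⟩ + e^{iθ} |1⟩) / √2`. -/
def unbiasedKet (θ : ℝ) : Path → ℂ :=
  ![1 / ((√2 : ℝ) : ℂ), Complex.exp (θ * Complex.I) / ((√2 : ℝ) : ℂ)]

/-- The unbiased input state `|ψ⟩⟨ψ|` with `|ψ⟩ = (|0⟩ + e^{iθ} |1⟩) / √2`. -/
def unbiasedInput (θ : ℝ) : Matrix Path Path ℂ :=
  Matrix.vecMulVec (unbiasedKet θ) (star (unbiasedKet θ))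

/-- The probability `p^{D₀}` that `D₀` clicks when the phase is set to `φ` and the state that
enters the interferometer is `ρ`. -/
def clickProb {F : Type*} [Fintype F] [DecidableEq F]
    (E : Matrix Path Path ℂ →ₗ[ℂ] Matrix (Path × F) (Path × F) ℂ)
    (ρP : Matrix Pol Pol ℂ) (R : ℝ) (ρ : Matrix Path Path ℂ) (φ : ℝ) : ℝ :=
  (qbsOutput ρP R (phaseShift φ (E ρ))).trace.re

/-- The fringe visibility `(p_max - p_min) / (p_max + p_min)`, the extrema of the click
probability of `D₀` being taken over the phase `φ`. -/
def visibility {F : Type*} [Fintype F] [DecidableEq F]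
    (E : Matrix Path Path ℂ →ₗ[ℂ] Matrix (Path × F) (Path × F) ℂ)
    (ρP : Matrix Pol Pol ℂ) (R : ℝ) (ρ : Matrix Path Path ℂ) : ℝ :=
  ((⨆ φ : ℝ, clickProb E ρP R ρ φ) - ⨅ φ : ℝ, clickProb E ρP R ρ φ) /
    ((⨆ φ : ℝ, clickProb E ρP R ρ φ) + ⨅ φ : ℝ, clickProb E ρP R ρ φ)

end QBS

end

noncomputable section

namespace QBS

/-! Put `S i j = ℬ(ℰ(|i⟩⟨j|))`. Complete positivity makes these blocks a positive semidefinite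
matrix, and both quantities of the duality are read off from it: the diagonal blocks are the states
to be discriminated, and `Tr (S 0 1)` is the coherence that produces the fringes.

Path preservation gives `Tr (S 0 0) + Tr (S 1 1) = 1`, so conditioning on the click just cancels the
factor `1/2` (`conditionalOutput_eq`). It also forces `Tr_F ℰ(|0⟩⟨1|)` to be a multiple of `|0⟩⟨1|`
(`traceEnv_single_eq_zero`), so the click probability is a cosine of amplitude `|Tr (S 0 1)|` about
`1/2`, and `𝒱 = 2 |Tr (S 0 1)|` (`visibility_unbiasedInput`).

For a measurement with success probability `p`, Cauchy–Schwarz for each outcome and then across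
outcomes gives `|Tr (S 0 1)|² ≤ p (1 - p)`, that is `(2p - 1)² + 𝒱² ≤ 1`
(`discrimination_sq_add_coherence_sq_le`). -/

/-- The amplitude `⟨0| U_p |q⟩` for a quanton in arm `q` with polarisation `p` to reach `D₀`. -/
def amplitude (R : ℝ) (p : Pol) (q : Path) : ℂ :=
  if p = 0 then (if q = 0 then 1 else 0) else beamSplitter R 0 q

lemma controlledBeamSplitterEnv_apply {F : Type*} [DecidableEq F] (R : ℝ)
    (p p' : Pol) (q : Path) (f f' : F) :
    controlledBeamSplitterEnv F R (p, 0, f) (p', q, f') =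
      if p = p' ∧ f = f' then amplitude R p q else 0 := by
  fin_cases p <;> fin_cases p' <;> fin_cases q <;>
    simp [controlledBeamSplitterEnv, controlledBeamSplitter, amplitude, proj, Matrix.one_apply]

/-! ### The beam splitter and detector in coordinates. -/

section Output

variable {F : Type*} [Fintype F] [DecidableEq F]

lemma detectD0_apply (X : Matrix (Pol × Path × F) (Pol × Path × F) ℂ) (x y : Pol × F) :
    detectD0 X x y = X (x.1, 0, x.2) (y.1, 0, y.2) := by
  have h : ((1 : Matrix Pol Pol ℂ) ⊗ₖ (proj (0 : Path) ⊗ₖ (1 : Matrix F F ℂ))) =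
      Matrix.diagonal fun z : Pol × Path × F => if z.2.1 = 0 then 1 else 0 := by
    ext ⟨p, q, f⟩ ⟨p', q', f'⟩
    fin_cases q <;> fin_cases q' <;>
      simp [proj, Matrix.one_apply, Matrix.diagonal_apply, ← ite_and, and_comm]
  simp [detectD0, h, Matrix.diagonal_mul]

lemma qbsOutput_apply (ρP : Matrix Pol Pol ℂ) (R : ℝ) (X : Matrix (Path × F) (Path × F) ℂ)
    (x y : Pol × F) :
    qbsOutput ρP R X x y = ∑ q, ∑ q', amplitude R x.1 q * ρP x.1 y.1 * X (q, x.2) (q', y.2) *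
      star (amplitude R y.1 q') := by
  rw [qbsOutput, detectD0_apply, Matrix.mul_apply]
  simp only [Matrix.mul_apply, Fintype.sum_prod_type, Matrix.conjTranspose_apply,
    controlledBeamSplitterEnv_apply, ite_and, ite_mul, zero_mul, Matrix.kroneckerMap_apply,
    Finset.sum_ite_irrel, Finset.sum_const_zero, Finset.sum_ite_eq, Finset.mem_univ, if_true,
    apply_ite star, star_zero, mul_ite, mul_zero]
  rw [Finset.sum_comm]
  simp [mul_assoc, Fin.sum_univ_two]
  ring

/-- The trace sees only the diagonal of `ρP`: the beam splitter is controlled by the polarisation,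
so `H` and `V` contribute incoherently, and only `V` makes the arms interfere. -/
lemma trace_qbsOutput (ρP : Matrix Pol Pol ℂ) {R : ℝ} (hR0 : 0 ≤ R) (hR1 : R ≤ 1)
    (X : Matrix (Path × F) (Path × F) ℂ) :
    (qbsOutput ρP R X).trace = (ρP 0 0 + ρP 1 1 * R) * traceEnv X 0 0 +
      ρP 1 1 * (1 - R) * traceEnv X 1 1 +
      ρP 1 1 * (√R * √(1 - R) : ℝ) * (traceEnv X 0 1 + traceEnv X 1 0) := by
  have h1 : ((√R : ℝ) : ℂ) * (√R : ℝ) = R := by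
    rw [← Complex.ofReal_mul, Real.mul_self_sqrt hR0]
  have h2 : ((√(1 - R) : ℝ) : ℂ) * (√(1 - R) : ℝ) = 1 - R := by
    rw [← Complex.ofReal_mul, Real.mul_self_sqrt (by linarith)]; simp
  simp only [Matrix.trace, Matrix.diag_apply, qbsOutput_apply, Fintype.sum_prod_type,
    Fin.sum_univ_two, amplitude, beamSplitter, traceEnv, Matrix.of_apply, Finset.mul_sum,
    ← Finset.sum_add_distrib]
  refine Finset.sum_congr rfl fun f _ => ?_
  simp
  linear_combination (ρP 1 1 * X (0, f) (0, f)) * h1 + (ρP 1 1 * X (1, f) (1, f)) * h2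

lemma traceEnv_phaseShift (φ : ℝ) (X : Matrix (Path × F) (Path × F) ℂ) (i j : Path) :
    traceEnv (phaseShift φ X) i j =
      phaseUnitary φ i i * traceEnv X i j * star (phaseUnitary φ j j) := by
  have h : phaseUnitary φ ⊗ₖ (1 : Matrix F F ℂ) =
      Matrix.diagonal fun z => phaseUnitary φ z.1 z.1 := by
    ext ⟨q, f⟩ ⟨q', f'⟩
    fin_cases q <;> fin_cases q' <;>
      simp [phaseUnitary, proj, Matrix.one_apply, Matrix.diagonal_apply]
  simp [traceEnv, phaseShift, h, Matrix.diagonal_conjTranspose, Finset.mul_sum, Finset.sum_mul]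

end Output

/-! ### Discrimination against coherence in positive block matrices. -/

section Blocks

variable {B : Type*} [Fintype B]

open scoped MatrixOrder Matrix.Norms.L2Operator in
/-- Applying a positive functional `X ↦ Tr (M X)` to the blocks of a positive semidefinite block
matrix gives a positive semidefinite matrix. -/
lemma posSemidef_trace_mul_blocks {k : Type*} [Fintype k] [DecidableEq k] [DecidableEq B]
    {S : k → k → Matrix B B ℂ}
    (hS : (Matrix.of fun x y : k × B => S x.1 y.1 x.2 y.2).PosSemidef)
    {M : Matrix B B ℂ} (hM : M.PosSemidef) :
    (Matrix.of fun i j => (M * S i j).trace).PosSemidef := by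
  -- With `M = C† C`, the matrix of traces is a sum over `b` of principal submatrices of `(1 ⊗ C) S
  -- (1 ⊗ C)†`.
  obtain ⟨C, rfl⟩ := CStarAlgebra.nonneg_iff_eq_star_mul_self.mp hM.nonneg
  have h := hS.mul_mul_conjTranspose_same ((1 : Matrix k k ℂ) ⊗ₖ C)
  have key : (Matrix.of fun i j => (Cᴴ * C * S i j).trace) = ∑ b : B,
      (((1 : Matrix k k ℂ) ⊗ₖ C) * (Matrix.of fun x y : k × B => S x.1 y.1 x.2 y.2) *
        ((1 : Matrix k k ℂ) ⊗ₖ C)ᴴ).submatrix (fun i => (i, b)) (fun i => (i, b)) := by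
    ext i j
    rw [Matrix.of_apply, mul_assoc, Matrix.trace_mul_comm, Matrix.sum_apply]
    refine Finset.sum_congr rfl fun b _ => ?_
    simp [Matrix.mul_apply, Fintype.sum_prod_type, Matrix.one_apply,
      apply_ite (starRingEnd ℂ)]
  rw [Matrix.star_eq_conjTranspose, key]
  exact Matrix.posSemidef_sum _ fun b _ => h.submatrix _

/-- Cauchy–Schwarz for the form `X ↦ Tr (M X)`: the `2 × 2` matrix of traces is positive
semidefinite, so its diagonal and determinant are nonnegative. -/
lemma normSq_trace_mul_le [DecidableEq B] {S : Fin 2 → Fin 2 → Matrix B B ℂ}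
    (hS : (Matrix.of fun x y : Fin 2 × B => S x.1 y.1 x.2 y.2).PosSemidef)
    {M : Matrix B B ℂ} (hM : M.PosSemidef) :
    0 ≤ (M * S 0 0).trace.re ∧ 0 ≤ (M * S 1 1).trace.re ∧
    ‖(M * S 0 1).trace‖ ^ 2 ≤ (M * S 0 0).trace.re * (M * S 1 1).trace.re := by
  have h := posSemidef_trace_mul_blocks hS hM
  have h0 := h.diag_nonneg (i := 0)
  have h1 := h.diag_nonneg (i := 1)
  have h10 := h.isHermitian.apply 1 0
  have hd := h.det_nonneg
  rw [Matrix.det_fin_two, ← h10] at hd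
  simp only [Matrix.of_apply] at h0 h1 hd
  rw [Complex.le_def] at h0 h1 hd
  refine ⟨h0.1, h1.1, ?_⟩
  have hd' := hd.1
  have i0 := h0.2
  simp only [Complex.zero_im, Complex.zero_re, Complex.sub_re, Complex.mul_re, Complex.star_def,
    Complex.conj_re, Complex.conj_im] at hd' i0
  rw [← i0] at hd'
  rw [← Complex.normSq_eq_norm_sq, Complex.normSq_apply]
  linarith

/-- For a positive semidefinite `2 × 2` block matrix of unit trace, the success probability of any
two-outcome measurement discriminating the diagonal blocks is bounded in terms of the trace of the
off-diagonal block. -/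
lemma discrimination_sq_add_coherence_sq_le [DecidableEq B] {S : Fin 2 → Fin 2 → Matrix B B ℂ}
    (hS : (Matrix.of fun x y : Fin 2 × B => S x.1 y.1 x.2 y.2).PosSemidef)
    (htr : (∑ j, (S j j).trace).re = 1)
    {M : Fin 2 → Matrix B B ℂ} (hM : ∀ j, (M j).PosSemidef) (hsum : ∑ j, M j = 1) :
    (2 * (∑ j, (M j * S j j).trace).re - 1) ^ 2 + 4 * ‖(S 0 1).trace‖ ^ 2 ≤ 1 := by
  obtain ⟨x0, y0, c0⟩ := normSq_trace_mul_le hS (hM 0)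
  obtain ⟨x1, y1, c1⟩ := normSq_trace_mul_le hS (hM 1)
  have hs : ∀ X : Matrix B B ℂ, X.trace = (M 0 * X).trace + (M 1 * X).trace := by
    intro X
    rw [← Matrix.trace_add, ← add_mul, ← Fin.sum_univ_two, hsum, one_mul]
  have hn : ‖(S 0 1).trace‖ ≤ ‖(M 0 * S 0 1).trace‖ + ‖(M 1 * S 0 1).trace‖ := by
    rw [hs (S 0 1)]; exact norm_add_le _ _
  rw [Fin.sum_univ_two, hs (S 0 0), hs (S 1 1)] at htr
  rw [Fin.sum_univ_two]
  simp only [Complex.add_re] at htr ⊢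
  set a := (M 0 * S 0 0).trace.re
  set b := (M 0 * S 1 1).trace.re
  set c := (M 1 * S 0 0).trace.re
  set d := (M 1 * S 1 1).trace.re
  have hu : ‖(M 0 * S 0 1).trace‖ ≤ √a * √b := by
    rw [← Real.sqrt_mul x0]; exact Real.le_sqrt_of_sq_le c0
  have hv : ‖(M 1 * S 0 1).trace‖ ≤ √c * √d := by
    rw [← Real.sqrt_mul x1]; exact Real.le_sqrt_of_sq_le c1
  have h : ‖(S 0 1).trace‖ ^ 2 ≤ (√a * √b + √c * √d) ^ 2 := by
    gcongr; linarith
  -- Cauchy–Schwarz for `(√a, √d)` and `(√b, √c)`: here `a + d` is the success probability and `b +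
  -- c` the error probability.
  have h' : (√a * √b + √c * √d) ^ 2 ≤ (a + d) * (b + c) := by
    have ha := Real.sq_sqrt x0
    have hb := Real.sq_sqrt y0
    have hc := Real.sq_sqrt x1
    have hd := Real.sq_sqrt y1
    rw [← ha, ← hb, ← hc, ← hd]
    simp only [Real.sqrt_sq (Real.sqrt_nonneg _)]
    nlinarith [sq_nonneg (√a * √c - √b * √d)]
  have hbc : b + c = 1 - (a + d) := by linarith
  rw [hbc] at h'
  linarith

lemma guessProb_sq_add_coherence_sq_le [DecidableEq B] {S : Fin 2 → Fin 2 → Matrix B B ℂ}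
    (hS : (Matrix.of fun x y : Fin 2 × B => S x.1 y.1 x.2 y.2).PosSemidef)
    (htr : (∑ j, (S j j).trace).re = 1) :
    (2 * guessProb (fun j => S j j) - 1) ^ 2 + 4 * ‖(S 0 1).trace‖ ^ 2 ≤ 1 := by
  set A := {p : ℝ | ∃ M : Fin 2 → Matrix B B ℂ, (∀ j, (M j).PosSemidef) ∧ ∑ j, M j = 1 ∧
    p = (∑ j, (M j * S j j).trace).re} with hA
  set s := √(1 - 4 * ‖(S 0 1).trace‖ ^ 2) with hs
  have hmem : ∀ p ∈ A, (2 * p - 1) ^ 2 ≤ 1 - 4 * ‖(S 0 1).trace‖ ^ 2 := by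
    rintro p ⟨M, hM, hsum, rfl⟩
    linarith [discrimination_sq_add_coherence_sq_le hS htr hM hsum]
  have habs : ∀ p ∈ A, |2 * p - 1| ≤ s := fun p hp => Real.abs_le_sqrt (hmem p hp)
  have hup : ∀ p ∈ A, p ≤ (1 + s) / 2 := fun p hp => by
    linarith [(abs_le.mp (habs p hp)).2]
  -- The square of `2 sSup A - 1` needs a lower bound on the supremum too; any single measurement
  -- supplies it, here the constant guess `0`.
  obtain ⟨p, hp⟩ : A.Nonempty := by
    refine ⟨_, ![1, 0], fun j => ?_, by simp, rfl⟩
    fin_cases j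
    · exact Matrix.PosSemidef.one
    · exact Matrix.PosSemidef.zero
  have h1 : sSup A ≤ (1 + s) / 2 := csSup_le ⟨p, hp⟩ hup
  have h2 : p ≤ sSup A := le_csSup ⟨_, hup⟩ hp
  have h3 := (abs_le.mp (habs p hp)).1
  have h4 : s ^ 2 = 1 - 4 * ‖(S 0 1).trace‖ ^ 2 :=
    Real.sq_sqrt ((sq_nonneg _).trans (hmem p hp))
  change (2 * sSup A - 1) ^ 2 + _ ≤ 1
  have h5 : (2 * sSup A - 1) ^ 2 ≤ s ^ 2 := sq_le_sq' (by linarith) (by linarith)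
  linarith

end Blocks

/-! ### Path-preserving channels, normalisation and fringes. -/

section Channel

variable {F : Type*} [Fintype F]
  {E : Matrix Path Path ℂ →ₗ[ℂ] Matrix (Path × F) (Path × F) ℂ}

/-- The Choi matrix of a channel is positive semidefinite. -/
lemma IsChannel.posSemidef_choi (hE : IsChannel E) :
    (Matrix.of fun x y : Fin 2 × (Path × F) =>
      E (Matrix.single x.1 y.1 1) x.2 y.2).PosSemidef := by
  -- The input is the unnormalised maximally entangled vector `∑ k, |k k⟩`.
  have h := hE.completelyPositive 2 _ (Matrix.posSemidef_vecMulVec_self_star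
    (fun z : Fin 2 × Path => if z.1 = z.2 then (1 : ℂ) else 0))
  refine (congrArg Matrix.PosSemidef ?_).mpr h
  ext x y
  simp only [ampliation, Matrix.of_apply]
  refine congrFun (congrFun (congrArg E ?_) x.2) y.2
  ext i j
  simp [Matrix.vecMulVec_apply, Matrix.single_apply, ← ite_and, and_comm]

/-- The Choi matrix of `Tr_F ∘ ℰ` is positive semidefinite, and path preservation kills its diagonal
entry at `(k, c)` when `k ≠ c`. A zero diagonal entry forces its row and column to vanish. -/
lemma traceEnv_single_eq_zero (hE : IsChannel E) (hpath : IsPathPreserving E)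
    {i j a b : Path} (h : i ≠ a ∨ j ≠ b) : traceEnv (E (Matrix.single i j 1)) a b = 0 := by
  classical
  have hN : (Matrix.of fun x y : Fin 2 × Path =>
      traceEnv (E (Matrix.single x.1 y.1 1)) x.2 y.2).PosSemidef := by
    have : (Matrix.of fun x y : Fin 2 × Path =>
        traceEnv (E (Matrix.single x.1 y.1 1)) x.2 y.2) = ∑ f : F,
        (Matrix.of fun x y : Fin 2 × (Path × F) =>
          E (Matrix.single x.1 y.1 1) x.2 y.2).submatrix
            (fun z => (z.1, z.2, f)) (fun z => (z.1, z.2, f)) := by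
      ext x y
      simp [traceEnv, Matrix.sum_apply]
    rw [this]
    exact Matrix.posSemidef_sum _ fun f _ => hE.posSemidef_choi.submatrix _
  -- In this `2 × 2` minor the product of the diagonal entries is zero, so the determinant is minus
  -- the squared modulus of the entry sought.
  have hd := (hN.submatrix ![(i, a), (j, b)]).det_nonneg
  have hh := hN.isHermitian.apply (j, b) (i, a)
  have e : ∀ k c : Path, traceEnv (E (Matrix.single k k 1)) c c = if k = c then 1 else 0 := by
    intro k c
    have := congrFun (congrFun (hpath k) c) c
    rw [proj] at this
    rw [this]
    simp [Matrix.single_apply]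
  have hz : (if i = a then (1 : ℂ) else 0) * (if j = b then 1 else 0) = 0 := by
    rcases h with h | h <;> simp [h]
  rw [Matrix.det_fin_two] at hd
  simp only [Matrix.of_apply] at hh
  simp only [Matrix.submatrix_apply, Matrix.of_apply, Matrix.cons_val_zero, Matrix.cons_val_one,
    e, hz] at hd
  rw [← hh, zero_sub, Complex.star_def, Complex.mul_conj, ← Complex.ofReal_neg,
    Complex.zero_le_real] at hd
  exact Complex.normSq_eq_zero.mp (le_antisymm (by linarith) (Complex.normSq_nonneg _))

variable [DecidableEq F]

/-- The blocks `ℬ(ℰ(|i⟩⟨j|))` form a positive semidefinite matrix. -/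
lemma posSemidef_qbsOutput_blocks (hE : IsChannel E) {ρP : Matrix Pol Pol ℂ}
    (hρP : ρP.PosSemidef) (R : ℝ) :
    (Matrix.of fun x y : Fin 2 × (Pol × F) =>
      qbsOutput ρP R (E (Matrix.single x.1 y.1 1)) x.2 y.2).PosSemidef := by
  -- The blocks are `K (ρP ⊗ Choi) K†`, where `K` applies `⟨0|_Q U_PQ` and leaves the input label
  -- and `F` alone.
  have h := (hρP.kronecker hE.posSemidef_choi).mul_mul_conjTranspose_same
    (Matrix.of fun (x : Fin 2 × (Pol × F)) (z : Pol × Fin 2 × (Path × F)) =>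
      if x.2.1 = z.1 then if x.1 = z.2.1 then if x.2.2 = z.2.2.2 then
        amplitude R x.2.1 z.2.2.1 else 0 else 0 else 0)
  refine (congrArg Matrix.PosSemidef ?_).mpr h
  ext ⟨i, p, f⟩ ⟨j, p', f'⟩
  rw [Matrix.of_apply, qbsOutput_apply, Matrix.mul_apply]
  simp only [Matrix.mul_apply, Fintype.sum_prod_type, Matrix.conjTranspose_apply,
    Matrix.of_apply, ite_mul, zero_mul, Matrix.kroneckerMap_apply,
    Finset.sum_ite_irrel, Finset.sum_const_zero, Finset.sum_ite_eq, Finset.mem_univ, if_true,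
    apply_ite star, star_zero, mul_ite, mul_zero]
  rw [Finset.sum_comm]
  simp [mul_assoc, Fin.sum_univ_two]
  ring

/-- Arm `0` contributes `ρ_HH + R ρ_VV` and arm `1` contributes `(1 - R) ρ_VV`; path preservation
removes the interference terms. -/
lemma sum_trace_qbsOutput (hpath : IsPathPreserving E) {ρP : Matrix Pol Pol ℂ}
    (hρP : IsState ρP) {R : ℝ} (hR0 : 0 ≤ R) (hR1 : R ≤ 1) :
    ∑ j, (qbsOutput ρP R (E (proj j))).trace = 1 := by
  have h := hρP.2
  rw [Matrix.trace_fin_two] at h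
  simp [Fin.sum_univ_two, trace_qbsOutput _ hR0 hR1, hpath _]
  simp [proj]
  linear_combination h

lemma conditionalOutput_eq (hpath : IsPathPreserving E) {ρP : Matrix Pol Pol ℂ}
    (hρP : IsState ρP) {R : ℝ} (hR0 : 0 ≤ R) (hR1 : R ≤ 1) (j : Fin 2) :
    conditionalOutput E ρP R j = qbsOutput ρP R (E (proj j)) := by
  simp only [conditionalOutput, jointOutput, Matrix.trace_smul, ← Finset.smul_sum,
    sum_trace_qbsOutput hpath hρP hR0 hR1, smul_smul]
  norm_num

lemma unbiasedInput_eq (θ : ℝ) :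
    unbiasedInput θ = (1 / 2 : ℂ) • (proj 0 + proj 1 +
      Complex.exp (-(θ * Complex.I)) • Matrix.single 0 1 1 +
      Complex.exp (θ * Complex.I) • Matrix.single 1 0 1) := by
  have h2 : ((√2 : ℝ) : ℂ) * (√2 : ℝ) = 2 := by
    rw [← Complex.ofReal_mul, Real.mul_self_sqrt (by norm_num)]; simp
  have h2' : (((√2 : ℝ) : ℂ))⁻¹ * ((√2 : ℝ) : ℂ)⁻¹ = 1 / 2 := by
    rw [← mul_inv, h2]; norm_num
  have he : Complex.exp (θ * Complex.I) * Complex.exp (-(θ * Complex.I)) = 1 := by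
    rw [← Complex.exp_add]; simp
  ext i j
  fin_cases i <;> fin_cases j <;>
    simp [unbiasedInput, unbiasedKet, Matrix.vecMulVec_apply, proj, div_eq_mul_inv,
      ← Complex.exp_conj]
  · linear_combination h2'
  · linear_combination Complex.exp (-(θ * Complex.I)) * h2'
  · linear_combination Complex.exp (θ * Complex.I) * h2'
  · linear_combination Complex.exp (θ * Complex.I) * Complex.exp (-(θ * Complex.I)) * h2' +
      1 / 2 * he

/-- The coherence `Tr ℬ(ℰ(|0⟩⟨1|))` determines the interference fringes at `D₀`. -/
lemma clickProb_unbiasedInput (hE : IsChannel E) (hpath : IsPathPreserving E)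
    {ρP : Matrix Pol Pol ℂ} (hρP : IsState ρP) {R : ℝ} (hR0 : 0 ≤ R) (hR1 : R ≤ 1) (θ φ : ℝ) :
    clickProb E ρP R (unbiasedInput θ) φ = 1 / 2 + ((qbsOutput ρP R
      (E (Matrix.single 0 1 1))).trace * Complex.exp (-((θ + φ : ℝ) * Complex.I))).re := by
  have hadd : ∀ X Y : Matrix (Path × F) (Path × F) ℂ,
      traceEnv (X + Y) = traceEnv X + traceEnv Y := fun X Y => by
    ext; simp [traceEnv, Finset.sum_add_distrib]
  have hsmul : ∀ (c : ℂ) (X : Matrix (Path × F) (Path × F) ℂ),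
      traceEnv (c • X) = c • traceEnv X := fun c X => by
    ext; simp [traceEnv, Finset.mul_sum]
  have hz := fun {i j a b : Path} => traceEnv_single_eq_zero hE hpath (i := i) (j := j)
    (a := a) (b := b)
  set g := traceEnv (E (Matrix.single 0 1 1)) 0 1 with hg
  have hg' : traceEnv (E (Matrix.single 1 0 1)) 1 0 = star g := by
    simp only [hg, traceEnv, Matrix.of_apply, star_sum]
    exact Finset.sum_congr rfl fun f _ =>
      (hE.posSemidef_choi.isHermitian.apply (1, 1, f) (0, 0, f)).symm
  have hv : star (ρP 1 1) = ρP 1 1 := hρP.1.isHermitian.apply 1 1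
  have htr := hρP.2
  rw [Matrix.trace_fin_two] at htr
  have hexp : Complex.exp (-((θ + φ : ℝ) * Complex.I)) =
      Complex.exp (-(θ * Complex.I)) * Complex.exp (-(φ * Complex.I)) := by
    rw [← Complex.exp_add]; push_cast; ring_nf
  have hφ : Complex.exp (φ * Complex.I) * Complex.exp (-(φ * Complex.I)) = 1 := by
    rw [← Complex.exp_add]; simp
  have hw : (qbsOutput ρP R (E (Matrix.single 0 1 1))).trace =
      ρP 1 1 * (√R * √(1 - R) : ℝ) * g := by
    rw [trace_qbsOutput _ hR0 hR1, hz (by simp), hz (by simp),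
      hz (i := 0) (j := 1) (a := 1) (b := 0) (by simp)]
    ring
  set w := (qbsOutput ρP R (E (Matrix.single 0 1 1))).trace
  -- The populations give `Tr ρP / 2`; as `ρ_VV` is real, the terms from `|0⟩⟨1|` and `|1⟩⟨0|` are
  -- complex conjugates.
  have hmain : (qbsOutput ρP R (phaseShift φ (E (unbiasedInput θ)))).trace =
      1 / 2 + (w * Complex.exp (-((θ + φ : ℝ) * Complex.I)) +
        star (w * Complex.exp (-((θ + φ : ℝ) * Complex.I)))) / 2 := by
    rw [trace_qbsOutput _ hR0 hR1]
    simp only [traceEnv_phaseShift, unbiasedInput_eq, map_smul, map_add, hadd, hsmul, hpath _,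
      Matrix.smul_apply, Matrix.add_apply, smul_eq_mul]
    rw [hz (i := 0) (j := 1) (a := 0) (b := 0) (by simp),
      hz (i := 1) (j := 0) (a := 0) (b := 0) (by simp),
      hz (i := 0) (j := 1) (a := 1) (b := 1) (by simp),
      hz (i := 1) (j := 0) (a := 1) (b := 1) (by simp),
      hz (i := 0) (j := 1) (a := 1) (b := 0) (by simp),
      hz (i := 1) (j := 0) (a := 0) (b := 1) (by simp), hg', ← hg, hw, hexp]
    simp only [star_mul', hv]
    simp [phaseUnitary, proj, ← Complex.exp_conj]
    linear_combination 1 / 2 * htr + 1 / 2 * ρP 1 1 * (1 - R) * hφ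
  rw [clickProb, hmain]
  generalize w * Complex.exp (-((θ + φ : ℝ) * Complex.I)) = z
  simp

lemma visibility_unbiasedInput (hE : IsChannel E) (hpath : IsPathPreserving E)
    {ρP : Matrix Pol Pol ℂ} (hρP : IsState ρP) {R : ℝ} (hR0 : 0 ≤ R) (hR1 : R ≤ 1) (θ : ℝ) :
    visibility E ρP R (unbiasedInput θ) =
      2 * ‖(qbsOutput ρP R (E (Matrix.single 0 1 1))).trace‖ := by
  have hp := clickProb_unbiasedInput hE hpath hρP hR0 hR1 θ
  set w := (qbsOutput ρP R (E (Matrix.single 0 1 1))).trace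
  have hnorm : ∀ φ : ℝ, |(w * Complex.exp (-((θ + φ : ℝ) * Complex.I))).re| ≤ ‖w‖ := by
    intro φ
    refine (Complex.abs_re_le_norm _).trans_eq ?_
    rw [norm_mul, ← neg_mul, ← Complex.ofReal_neg, Complex.norm_exp_ofReal_mul_I, mul_one]
  -- The phase `φ = arg w - θ` aligns the coherence with the positive real axis; a shift by `π`
  -- reverses it. The extrema `1/2 ± ‖w‖` sum to `1`, so the denominator of the visibility is
  -- trivial.
  have hpeak : w * Complex.exp (-((θ + (w.arg - θ) : ℝ) * Complex.I)) = ‖w‖ := by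
    conv_lhs => rw [← Complex.norm_mul_exp_arg_mul_I w]
    rw [mul_assoc, ← Complex.exp_add]
    simp
  have hdip : w * Complex.exp (-((θ + (w.arg - θ - Real.pi) : ℝ) * Complex.I)) = -‖w‖ := by
    rw [← hpeak, show -(((θ + (w.arg - θ - Real.pi) : ℝ) : ℂ) * Complex.I) =
      -((θ + (w.arg - θ) : ℝ) * Complex.I) + Real.pi * Complex.I by push_cast; ring,
      Complex.exp_add, Complex.exp_pi_mul_I]
    ring
  have hsup : IsGreatest (Set.range (clickProb E ρP R (unbiasedInput θ))) (1 / 2 + ‖w‖) := by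
    refine ⟨⟨w.arg - θ, by rw [hp, hpeak, Complex.ofReal_re]⟩, ?_⟩
    rintro _ ⟨φ, rfl⟩
    rw [hp]
    linarith [(abs_le.mp (hnorm φ)).2]
  have hinf : IsLeast (Set.range (clickProb E ρP R (unbiasedInput θ))) (1 / 2 - ‖w‖) := by
    refine ⟨⟨w.arg - θ - Real.pi, by
      rw [hp, hdip, Complex.neg_re, Complex.ofReal_re, sub_eq_add_neg]⟩, ?_⟩
    rintro _ ⟨φ, rfl⟩
    rw [hp]
    linarith [(abs_le.mp (hnorm φ)).1]
  rw [visibility, iSup, iInf, hsup.csSup_eq, hinf.csInf_eq]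
  ring

end Channel

end QBS

end

theorem mainTheorem2 {F : Type*} [Fintype F] [DecidableEq F]
    (E : Matrix QBS.Path QBS.Path ℂ →ₗ[ℂ] Matrix (QBS.Path × F) (QBS.Path × F) ℂ)
    (hE : QBS.IsChannel E) (hpath : QBS.IsPathPreserving E)
    (ρP : Matrix QBS.Pol QBS.Pol ℂ) (hρP : QBS.IsState ρP)
    (R : ℝ) (hR0 : 0 ≤ R) (hR1 : R ≤ 1) (θ : ℝ) :
    QBS.inputDistinguishability E ρP R ^ 2 +
      QBS.visibility E ρP R (QBS.unbiasedInput θ) ^ 2 ≤ 1 := by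
  rw [QBS.visibility_unbiasedInput hE hpath hρP hR0 hR1, QBS.inputDistinguishability,
    funext (QBS.conditionalOutput_eq hpath hρP hR0 hR1), mul_pow]
  norm_num1
  exact QBS.guessProb_sq_add_coherence_sq_le
    (S := fun i j => QBS.qbsOutput ρP R (E (Matrix.single i j 1)))
    (QBS.posSemidef_qbsOutput_blocks hE hρP.1 R)
    (congrArg Complex.re (QBS.sum_trace_qbsOutput hpath hρP hR0 hR1))
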